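/- **Setting.** Let $G=\mathbb Z_{12}\times\mathbb Z_6$, written multiplicatively with generators $x,y$ ($x^{12}=y^6=1$), let $A=x^3+y+y^2$, $B=y^3+x+x^2$, viewed as $72\times72$ matrices over $\mathbb F_2$. The gross code is the $[[144,12,12]]$ CSS code with $H_X=[A\mid B]$ and $H_Z=[B^{\mathsf T}\mid A^{\mathsf T}]$; its rows are its $72$ $X$ checks and $72$ $Z$ checks, all of weight six, and $G$ acts by translations on checks and data qubits. A *syndrome extraction circuit* (SEC) measures each check with its own ancilla qubit, the same one in each round: for an $X$ check the ancilla is prepared in $|+\rangle$, CNOTs are applied from the ancilla to each data qubit in the support of the check, and the ancilla is measured in the $X$ basis; for a $Z$ check the ancilla is prepared in $|0\rangle$, CNOTs are applied from each data qubit in the support to the ancilla, and the ancilla is measured in the $Z$ basis. The SEC is specified by the time steps of these operations within a round; each operation takes one time step and no qubit takes part in two operations at the same time. Rounds may be staggered (overlap in time), but on every qubit the operations of one round precede those of the next. The SEC is *non-interleaved* if, within a round, either every $X$-type CNOT precedes every $Z$-type CNOT on the same data qubit, or every $Z$-type CNOT precedes every $X$-type CNOT on the same data qubit. It is *uniformly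 tiled* if all $X$ checks use the same local CNOT ordering, i.e. the order of the six CNOTs of any $X$ check is carried by each translation to the order of the six CNOTs of the translated $X$ check (no condition is put on the $Z$ checks). An $X$-basis ($Z$-basis) memory experiment with $m$ rounds prepares all data qubits in $|+\rangle$ ($|0\rangle$), runs $m$ rounds of the SEC, and measures all data qubits in the $X$ ($Z$) basis. The error mechanisms are: a non-identity one-qubit Pauli on an idling qubit during a time step; a non-identity two-qubit Pauli after a CNOT; a preparation of the orthogonal state; a flip of a measurement outcome. (Preparation and final measurement of the data qubits may be taken as noisy or as perfect.) The detectors are the parities of the outcomes of a check in consecutive rounds and, for the checks of the type of the experiment, also the outcome in the first round and the parity of the outcome in the last round with the value of the check computed from the final data measurement. The logical observables are the logical operators of the type of the experiment, read off from the final data measurement. Let $d^X_{\mathrm{circ}}$ (resp. $d^Z_{\mathrm{circ}}$) be the minimum number of error mechanisms in the $X$-basis (resp. $Z$-basis) experiment that together flip no detector but flip at least one logical observable, and let the circuit distance be $d_{\mathrm{circ}}=\min(d^X_{\mathrm{circ}},d^Z_{\mathrm{circ}})$. **Proposition (Uniformly-tiled gross circuits).** For every uniformly tiled non-interleaved SEC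 for the gross code, every number $m\ge1$ of rounds, and either convention for the noise of the data preparation and final data measurement, $$d_{\mathrm{circ}}\le 10 .$$ -/

import Mathlib

/-! ### Noisy circuits of preparations, measurements and CNOT gates -/

/-- The two bases for preparation and measurement: `|+⟩, |-⟩` for `X` and `|0⟩, |1⟩` for `Z`. -/
inductive Basis where
  | X
  | Z
  deriving DecidableEq

/-- A one-qubit Pauli operator modulo phases: `(x, z)` stands for `X ^ x * Z ^ z`. -/
abbrev Pauli : Type := ZMod 2 × ZMod 2

/-- The Pauli operator that exchanges the two states of a basis. -/
def Basis.flip : Basis → Pauli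
  | .X => (0, 1)
  | .Z => (1, 0)

/-- `1` when the Pauli operator `P` flips the outcome of a measurement in the basis `b`, else `0`. -/
def Basis.detects (b : Basis) (P : Pauli) : ZMod 2 :=
  match b with
  | .X => P.2
  | .Z => P.1

/-- The circuit operations other than idling. -/
inductive Gate (Q : Type) where
  | prep (b : Basis) (q : Q)
  | meas (b : Basis) (q : Q)
  | cnot (control target : Q)
  deriving DecidableEq

/-- The gate `g` acts on the qubit `q`. -/
def Gate.ActsOn {Q : Type} (g : Gate Q) (q : Q) : Prop :=
  match g with
  | .prep _ p => p = q
  | .meas _ p => p = q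
  | .cnot c t => c = q ∨ t = q

/-- The change that a gate makes to a Pauli frame `F`. A preparation erases the Pauli operator on
its qubit; a CNOT copies `X` from control to target and `Z` from target to control. -/
def Gate.kick {Q : Type} [DecidableEq Q] (g : Gate Q) (F : Q → Pauli) (q : Q) : Pauli :=
  match g with
  | .prep _ p => if q = p then - F q else 0
  | .meas _ _ => 0
  | .cnot c t => (if q = t then (F c).1 else 0, if q = c then (F t).2 else 0)

/-- A circuit: a finite set of gates, each with its time step. Every gate takes one time step. -/
abbrev Circuit (Q : Type) : Type := Finset (ℕ × Gate Q)

/-- Single error mechanisms of circuit noise. -/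
inductive Fault (Q : Type) where
  | prepFlip (t : ℕ) (b : Basis) (q : Q)
  | measFlip (t : ℕ) (b : Basis) (q : Q)
  | cnotPauli (t : ℕ) (control target : Q) (P P' : Pauli)
  | idlePauli (t : ℕ) (q : Q) (P : Pauli)

/-- The error mechanisms of a circuit: a preparation may prepare the wrong state of its basis, the
outcome of a measurement may be flipped, a CNOT may be followed by any non-identity two-qubit Pauli
operator, and a qubit that idles during a time step (between the start and the end of the circuit)
may undergo any non-identity one-qubit Pauli operator. -/
def Fault.OccursIn {Q : Type} (f : Fault Q) (C : Circuit Q) : Prop :=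
  match f with
  | .prepFlip t b q => (t, Gate.prep b q) ∈ C
  | .measFlip t b q => (t, Gate.meas b q) ∈ C
  | .cnotPauli t c g P P' => (t, Gate.cnot c g) ∈ C ∧ (P, P') ≠ 0
  | .idlePauli t q P =>
      (∀ g, (t, g) ∈ C → ¬ g.ActsOn q) ∧ (∃ a ∈ C, t ≤ a.1) ∧ P ≠ 0

/-- The Pauli operator that a fault inserts on the qubit `q` directly after the time step `s`. -/
def Fault.error {Q : Type} [DecidableEq Q] (f : Fault Q) (s : ℕ) (q : Q) : Pauli :=
  match f with
  | .prepFlip t b p => if t = s ∧ p = q then b.flip else 0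
  | .measFlip _ _ _ => 0
  | .cnotPauli t c g P P' => if t = s then (if q = c then P else if q = g then P' else 0) else 0
  | .idlePauli t p P => if t = s ∧ p = q then P else 0

/-- `1` when the fault is the classical flip of the outcome of the measurement of the qubit `q` in
the basis `b` at the time step `s`. -/
def Fault.readout {Q : Type} [DecidableEq Q] (f : Fault Q) (s : ℕ) (b : Basis) (q : Q) : ZMod 2 :=
  match f with
  | .measFlip t b' p => if t = s ∧ b' = b ∧ p = q then 1 else 0
  | _ => 0

/-- The Pauli frame of the error configuration `E` just before the time step `t`: the Pauli operator
by which the faults of the earlier time steps, propagated through the circuit, have changed the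
state. -/
def frame {Q : Type} [DecidableEq Q] (C : Circuit Q) (E : Finset (Fault Q)) : ℕ → Q → Pauli
  | 0 => 0
  | t + 1 => fun q =>
      frame C E t q + ∑ a ∈ C.filter (fun a => a.1 = t), a.2.kick (frame C E t) q
        + ∑ f ∈ E, f.error t q

/-- Whether (`1`) or not (`0`) the error configuration `E` flips the outcome of the measurement of
the qubit `q` in the basis `b` at the time step `t`. -/
def outcomeFlip {Q : Type} [DecidableEq Q] (C : Circuit Q) (E : Finset (Fault Q))
    (t : ℕ) (b : Basis) (q : Q) : ZMod 2 :=
  b.detects (frame C E t q) + ∑ f ∈ E, f.readout t b q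

/-! ### CSS codes and syndrome extraction circuits -/

/-- A CSS code with `X` checks `ι`, `Z` checks `κ` and data qubits `D`. -/
structure CSSCode (ι κ D : Type) [Fintype D] where
  HX : Matrix ι D (ZMod 2)
  HZ : Matrix κ D (ZMod 2)
  comm : HX * HZ.transpose = 0

section

variable {ι κ D : Type} [Fintype ι] [Fintype κ] [Fintype D]
  [DecidableEq ι] [DecidableEq κ] [DecidableEq D]

/-- The set of data qubits in a check; `Sum.inl i` is an `X` check and `Sum.inr k` a `Z` check. -/
def CSSCode.support (C : CSSCode ι κ D) : ι ⊕ κ → Finset D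
  | .inl i => Finset.univ.filter fun j => C.HX i j = 1
  | .inr k => Finset.univ.filter fun j => C.HZ k j = 1

/-- The basis in which the ancilla of a check is prepared and measured. -/
def checkBasis : ι ⊕ κ → Basis
  | .inl _ => .X
  | .inr _ => .Z

/-- The qubits of an extraction circuit: the data qubits and one ancilla for each check. -/
abbrev Qubit (ι κ D : Type) : Type := D ⊕ (ι ⊕ κ)

/-- The CNOT between the ancilla of a check and a data qubit: the ancilla of an `X` check is the
control, the ancilla of a `Z` check is the target. -/
def checkCnot (c : ι ⊕ κ) (j : D) : Gate (Qubit ι κ D) :=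
  match c with
  | .inl i => .cnot (.inr (.inl i)) (.inl j)
  | .inr k => .cnot (.inl j) (.inr (.inr k))

/-- A (repeated, possibly staggered) single-ancilla, CNOT-based syndrome extraction circuit. For
each check it specifies the time steps, within a round, of the preparation of the ancilla, of the
CNOTs with the data qubits in its support and of the measurement of the ancilla. In round `r` these
are shifted by `start r`; rounds may overlap in time, but on each single qubit the operations of a
round precede those of the later rounds. -/
structure SEC (C : CSSCode ι κ D) where
  prep : ι ⊕ κ → ℕ
  cnot : ι ⊕ κ → D → ℕ
  meas : ι ⊕ κ → ℕ
  start : ℕ → ℕ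
  prep_lt_cnot : ∀ c, ∀ j ∈ C.support c, prep c < cnot c j
  cnot_lt_meas : ∀ c, ∀ j ∈ C.support c, cnot c j < meas c
  /-- The ancilla takes part in one CNOT at a time. -/
  cnot_ne_of_check : ∀ c, ∀ j ∈ C.support c, ∀ j' ∈ C.support c, j ≠ j' → cnot c j ≠ cnot c j'
  /-- A data qubit takes part in one CNOT at a time. -/
  cnot_ne_of_data : ∀ c c' j, j ∈ C.support c → j ∈ C.support c' → c ≠ c' → cnot c j ≠ cnot c' j
  round_ancilla : ∀ r s, r < s → ∀ c, start r + meas c < start s + prep c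
  round_data : ∀ r s, r < s → ∀ c c' j, j ∈ C.support c → j ∈ C.support c' →
    start r + cnot c j < start s + cnot c' j
  /-- The circuit measures the checks: an `X` check acts before a `Z` check on an even number of
  their common data qubits. (Non-interleaved circuits always satisfy this.) -/
  measures_checks : ∀ i k,
    Even ((C.support (.inl i) ∩ C.support (.inr k)).filter
      (fun j => cnot (.inl i) j < cnot (.inr k) j)).card

namespace SEC

variable {C : CSSCode ι κ D}

/-- All `X`-type CNOTs precede all `Z`-type CNOTs of the same round on the same data qubit, or the
other way round. -/
def NonInterleaved (S : SEC C) : Prop :=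
  (∀ i k j, j ∈ C.support (.inl i) → j ∈ C.support (.inr k) →
    S.cnot (.inl i) j < S.cnot (.inr k) j) ∨
  (∀ i k j, j ∈ C.support (.inl i) → j ∈ C.support (.inr k) →
    S.cnot (.inr k) j < S.cnot (.inl i) j)

/-- In a memory experiment the data qubits are prepared at time step `0`, and round `r` is shifted
by `begin r`. -/
def begin (S : SEC C) (r : ℕ) : ℕ := S.start r + 1

/-- The time step, after the end of all `m` rounds, at which the data qubits are measured. -/
def readoutTime (S : SEC C) (m : ℕ) : ℕ :=
  (Finset.range m).sup (fun r => Finset.univ.sup (fun c => S.begin r + S.meas c)) + 1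

/-- The memory experiment in the basis `b` with `m` rounds: all data qubits are prepared in the
basis `b`, `m` rounds of the extraction circuit are run, and all data qubits are measured in the
basis `b`. -/
def memory (S : SEC C) (b : Basis) (m : ℕ) : Circuit (Qubit ι κ D) :=
  (Finset.univ.image fun j : D => (0, Gate.prep b (.inl j)))
  ∪ ((Finset.range m).biUnion fun r => Finset.univ.biUnion fun c : ι ⊕ κ =>
      {(S.begin r + S.prep c, Gate.prep (checkBasis c) (.inr c))}
      ∪ ((C.support c).image fun j => (S.begin r + S.cnot c j, checkCnot c j))
      ∪ {(S.begin r + S.meas c, Gate.meas (checkBasis c) (.inr c))})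
  ∪ (Finset.univ.image fun j : D => (S.readoutTime m, Gate.meas b (.inl j)))

/-- The fault is a flip of the initial preparation or of the final measurement of a data qubit. -/
def IsBoundary (f : Fault (Qubit ι κ D)) : Prop :=
  match f with
  | .prepFlip _ _ (.inl _) => True
  | .measFlip _ _ (.inl _) => True
  | _ => False

/-- The error configurations of the memory experiment: the finite sets of its error mechanisms. The
initial preparation and the final measurement of the data qubits are noisy if `noisyBoundary` is
`true`, and perfect otherwise. -/
def IsConfiguration (S : SEC C) (b : Basis) (m : ℕ) (noisyBoundary : Bool)
    (E : Finset (Fault (Qubit ι κ D))) : Prop :=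
  ∀ f ∈ E, f.OccursIn (S.memory b m) ∧ (noisyBoundary = true ∨ ¬ IsBoundary f)

/-- Whether the outcome of the check `c` in round `r` is flipped. -/
def checkFlip (S : SEC C) (b : Basis) (m : ℕ) (E : Finset (Fault (Qubit ι κ D)))
    (r : ℕ) (c : ι ⊕ κ) : ZMod 2 :=
  outcomeFlip (S.memory b m) E (S.begin r + S.meas c) (checkBasis c) (.inr c)

/-- Whether the outcome of the final measurement of the data qubit `j` is flipped. -/
def dataFlip (S : SEC C) (b : Basis) (m : ℕ) (E : Finset (Fault (Qubit ι κ D)))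
    (j : D) : ZMod 2 :=
  outcomeFlip (S.memory b m) E (S.readoutTime m) b (.inl j)

/-- No detector is flipped. The detectors compare the outcomes of each check in consecutive rounds.
For the checks of the type `b`, moreover, the outcome in the first round is a detector by itself,
and the outcome in the last round is compared with the value of the check that is computed from the
final measurement of the data qubits. -/
def Undetected (S : SEC C) (b : Basis) (m : ℕ) (E : Finset (Fault (Qubit ι κ D))) : Prop :=
  (∀ r c, r + 1 < m → S.checkFlip b m E r c + S.checkFlip b m E (r + 1) c = 0) ∧
  (∀ c, checkBasis c = b → 0 < m → S.checkFlip b m E 0 c = 0) ∧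
  (∀ c, checkBasis c = b → 0 < m →
    S.checkFlip b m E (m - 1) c + ∑ j ∈ C.support c, S.dataFlip b m E j = 0)

/-- The supports of the logical operators of type `b`: they commute with the checks of the other
type and are not products of checks of the type `b`. -/
def IsLogical (C : CSSCode ι κ D) (b : Basis) (v : D → ZMod 2) : Prop :=
  match b with
  | .X => C.HZ.mulVec v = 0 ∧ v ∉ Submodule.span (ZMod 2) (Set.range C.HX.row)
  | .Z => C.HX.mulVec v = 0 ∧ v ∉ Submodule.span (ZMod 2) (Set.range C.HZ.row)

/-- The error configuration flips at least one logical observable of type `b`, as it is read off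
from the final measurement of the data qubits. -/
def FlipsLogical (S : SEC C) (b : Basis) (m : ℕ) (E : Finset (Fault (Qubit ι κ D))) : Prop :=
  ∃ v, IsLogical C b v ∧ ∑ j, v j * S.dataFlip b m E j = 1

/-- The circuit distance for the memory experiment in the basis `b` with `m` rounds: the least
number of error mechanisms that flip no detector but at least one logical observable (`⊤` if there
are none). -/
noncomputable def basisDistance (S : SEC C) (m : ℕ) (noisyBoundary : Bool) (b : Basis) : ℕ∞ :=
  sInf {n : ℕ∞ | ∃ E : Finset (Fault (Qubit ι κ D)), S.IsConfiguration b m noisyBoundary E ∧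
    S.Undetected b m E ∧ S.FlipsLogical b m E ∧ n = (E.card : ℕ∞)}

/-- The circuit distance: the smaller one of the distances for the two bases. -/
noncomputable def circuitDistance (S : SEC C) (m : ℕ) (noisyBoundary : Bool) : ℕ∞ :=
  min (S.basisDistance m noisyBoundary .X) (S.basisDistance m noisyBoundary .Z)

end SEC

end

/-! ### The gross code -/

/-- The group `⟨x⟩ × ⟨y⟩` with `x ^ 12 = y ^ 6 = 1`, written additively: `(a, b)` is `x^a y^b`. -/
abbrev GrossGroup : Type := ZMod 12 × ZMod 6

/-- The polynomial `x ^ 3 + y + y ^ 2`, as the set of its monomials. -/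
def grossA : Finset GrossGroup := {(3, 0), (0, 1), (0, 2)}

/-- The polynomial `y ^ 3 + x + x ^ 2`, as the set of its monomials. -/
def grossB : Finset GrossGroup := {(0, 3), (1, 0), (2, 0)}

/-- The matrix of a polynomial `P` in the cyclic shifts `x` and `y`. -/
def shiftMatrix (P : Finset GrossGroup) : Matrix GrossGroup GrossGroup (ZMod 2) :=
  Matrix.of fun g h => if h - g ∈ P then 1 else 0

/-- The gross code: `H_X = [A | B]` and `H_Z = [Bᵀ | Aᵀ]`. -/
def grossCode : CSSCode GrossGroup GrossGroup (GrossGroup ⊕ GrossGroup) where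
  HX := Matrix.fromCols (shiftMatrix grossA) (shiftMatrix grossB)
  HZ := Matrix.fromCols (shiftMatrix grossB).transpose (shiftMatrix grossA).transpose
  comm := by
    rw [Matrix.transpose_fromCols, Matrix.fromCols_mul_fromRows, Matrix.transpose_transpose,
      Matrix.transpose_transpose]
    ext g k
    have h : ∑ h, shiftMatrix grossB g h * shiftMatrix grossA h k
        = ∑ h, shiftMatrix grossA g h * shiftMatrix grossB h k := by
      refine Fintype.sum_equiv (Equiv.subLeft (g + k)) _ _ fun h => ?_
      have e1 : g + k - h - g = k - h := by abel
      have e2 : k - (g + k - h) = h - g := by abel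
      simp only [shiftMatrix, Matrix.of_apply, Equiv.subLeft_apply, e1, e2, mul_comm]
    rw [Matrix.add_apply, Matrix.mul_apply, Matrix.mul_apply, h, CharTwo.add_self_eq_zero]
    rfl

/-- The translation by `u` of the data qubits of the gross code. -/
def shiftData (u : GrossGroup) : GrossGroup ⊕ GrossGroup → GrossGroup ⊕ GrossGroup :=
  Sum.map (u + ·) (u + ·)

/-- All `X` checks use the same local order of their CNOTs, up to translation. -/
def UniformlyTiled (S : SEC grossCode) : Prop :=
  ∀ g u : GrossGroup, ∀ j ∈ grossCode.support (.inl g), ∀ j' ∈ grossCode.support (.inl g),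
    (S.cnot (.inl g) j < S.cnot (.inl g) j' ↔
      S.cnot (.inl (u + g)) (shiftData u j) < S.cnot (.inl (u + g)) (shiftData u j'))

/-!
Consider the `Z`-basis experiment, and in it only `X`-type errors after CNOTs of `X` checks in the
first round. They never reach the outcome of an `X` check. As the circuit is non-interleaved, every
`Z` check sees, in each round, either the whole `X` error that they leave on the data qubits or
nothing of it. Hence they flip no detector as soon as this residual error commutes with the `Z`
checks, and the residual error matters only up to `X` checks.

An `X` error on the ancilla directly after its fourth CNOT spreads to the last two data qubits of
the check; after its second CNOT it leaves, up to the check itself, an `X` error on the first two.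
As the circuit is uniformly tiled, the positions of these two disjoint pairs are the same in all `X`
checks. For all but two of the 15 pairs of positions, some logical `X` operator of the gross code is
made of translates of the pair and of single data qubits, at most 10 in total. The two exceptional
pairs matter only when the circuit has both of them, and then ten faults that use both suffice.
-/

section Frame

variable {Q : Type} [DecidableEq Q]

theorem Gate.kick_zero (g : Gate Q) : g.kick 0 = 0 := by
  funext q
  cases g <;> simp [Gate.kick]

theorem Gate.kick_add (g : Gate Q) (F F' : Q → Pauli) :
    g.kick (F + F') = g.kick F + g.kick F' := by
  funext q
  cases g with
  | prep b p =>
    simp only [Gate.kick, Pi.add_apply]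
    split_ifs
    · exact neg_add _ _
    · exact (add_zero 0).symm
  | meas b p => exact (add_zero 0).symm
  | cnot c t => ext <;> simp only [Gate.kick, Pi.add_apply, Prod.fst_add, Prod.snd_add] <;>
      split_ifs <;> simp

theorem Gate.kick_sum {α : Type*} (g : Gate Q) (s : Finset α) (F : α → Q → Pauli) :
    g.kick (∑ i ∈ s, F i) = ∑ i ∈ s, g.kick (F i) :=
  map_sum (⟨⟨g.kick, g.kick_zero⟩, g.kick_add⟩ : (Q → Pauli) →+ (Q → Pauli)) F s

theorem Gate.kick_eq_zero_of_not_actsOn {g : Gate Q} {q : Q} (h : ¬ g.ActsOn q)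
    (F : Q → Pauli) : g.kick F q = 0 := by
  cases g with
  | prep b p => exact if_neg (Ne.symm h)
  | meas b p => rfl
  | cnot c t =>
    obtain ⟨hc, ht⟩ := not_or.1 h
    simp only [Gate.kick, if_neg (Ne.symm hc), if_neg (Ne.symm ht), Prod.mk_zero_zero]

theorem Gate.kick_snd_eq_zero (g : Gate Q) {F : Q → Pauli} (hF : ∀ q, (F q).2 = 0) (q : Q) :
    (g.kick F q).2 = 0 := by
  cases g with
  | prep b p =>
    simp only [Gate.kick]
    split_ifs <;> simp [hF]
  | meas b p => rfl
  | cnot c t => simp [Gate.kick, hF]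

theorem frame_eq_sum_singleton (C : Circuit Q) (E : Finset (Fault Q)) (t : ℕ) :
    frame C E t = ∑ f ∈ E, frame C {f} t := by
  induction t with
  | zero => simp [frame]
  | succ t ih =>
    funext q
    simp only [frame, Finset.sum_apply, ih, Gate.kick_sum, Finset.sum_add_distrib,
      Finset.sum_singleton]
    rw [Finset.sum_comm (s := E)]

theorem outcomeFlip_eq_sum_singleton (C : Circuit Q) (E : Finset (Fault Q)) (t : ℕ) (b : Basis)
    (q : Q) : outcomeFlip C E t b q = ∑ f ∈ E, outcomeFlip C {f} t b q := by
  have hdetects : b.detects (frame C E t q) = ∑ f ∈ E, b.detects (frame C {f} t q) := by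
    rw [frame_eq_sum_singleton, Finset.sum_apply]
    cases b with
    | X => exact Prod.snd_sum
    | Z => exact Prod.fst_sum
  simp only [outcomeFlip, hdetects, Finset.sum_add_distrib, Finset.sum_singleton]

theorem frame_snd_eq_zero (C : Circuit Q) {E : Finset (Fault Q)}
    (hE : ∀ f ∈ E, ∀ t q, (f.error t q).2 = 0) (t : ℕ) (q : Q) : (frame C E t q).2 = 0 := by
  induction t generalizing q with
  | zero => rfl
  | succ t ih =>
    simp only [frame, Prod.snd_add, Prod.snd_sum, ih, zero_add]
    rw [Finset.sum_eq_zero fun a _ => a.2.kick_snd_eq_zero ih q,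
      Finset.sum_eq_zero fun f hf => hE f hf t q, add_zero]

theorem frame_eq_frame_add_sum (C : Circuit Q) (E : Finset (Fault Q)) {s t : ℕ} (hst : s ≤ t)
    (q : Q) : frame C E t q = frame C E s q
      + ∑ a ∈ C with a.1 ∈ Finset.Ico s t, a.2.kick (frame C E a.1) q
      + ∑ u ∈ Finset.Ico s t, ∑ f ∈ E, f.error u q := by
  induction t, hst using Nat.le_induction with
  | base => simp
  | succ t hst ih =>
    have hkick : ∑ a ∈ C with a.1 = t, a.2.kick (frame C E t) q
        = ∑ a ∈ C with a.1 = t, a.2.kick (frame C E a.1) q :=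
      Finset.sum_congr rfl fun a ha => by rw [(Finset.mem_filter.1 ha).2]
    simp only [frame, Nat.Ico_succ_right_eq_insert_Ico hst, Finset.mem_insert,
      Finset.sum_insert Finset.right_notMem_Ico, Finset.filter_or]
    rw [Finset.sum_union, ih, hkick]
    · abel
    · exact Finset.disjoint_filter.2 fun a _ h => by simp [h]

end Frame

section Memory

variable {ι κ D : Type}

theorem checkCnot_actsOn_data {c : ι ⊕ κ} {j j' : D} :
    (checkCnot c j).ActsOn (.inl j') ↔ j = j' := by
  cases c <;> simp [checkCnot, Gate.ActsOn]

theorem checkCnot_actsOn_ancilla {c c' : ι ⊕ κ} {j : D} :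
    (checkCnot c j).ActsOn (.inr c') ↔ c = c' := by
  cases c <;> simp [checkCnot, Gate.ActsOn]

theorem checkCnot_injective (c : ι ⊕ κ) :
    Function.Injective (checkCnot c : D → Gate (Qubit ι κ D)) := fun j j' h => by
  rw [← checkCnot_actsOn_data (c := c), h, checkCnot_actsOn_data]

theorem checkCnot_ne_prep (c : ι ⊕ κ) (j : D) (b : Basis) (q : Qubit ι κ D) :
    checkCnot c j ≠ .prep b q := by
  cases c <;> simp [checkCnot]

theorem checkCnot_ne_meas (c : ι ⊕ κ) (j : D) (b : Basis) (q : Qubit ι κ D) :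
    checkCnot c j ≠ .meas b q := by
  cases c <;> simp [checkCnot]

namespace SEC

variable [Fintype D] [DecidableEq D] {C : CSSCode ι κ D} (S : SEC C)

theorem strictMono_start {c : ι ⊕ κ} (hc : S.prep c < S.meas c) : StrictMono S.start :=
  fun r s hrs => by
    have := S.round_ancilla r s hrs c
    lia

variable [DecidableEq ι] [DecidableEq κ]

/-- The gates of the check `c` in the round `r` of a memory experiment. -/
def checkGates (r : ℕ) (c : ι ⊕ κ) : Circuit (Qubit ι κ D) :=
  {(S.begin r + S.prep c, .prep (checkBasis c) (.inr c))}
    ∪ (C.support c).image (fun j => (S.begin r + S.cnot c j, checkCnot c j))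
    ∪ {(S.begin r + S.meas c, .meas (checkBasis c) (.inr c))}

variable {S}

theorem mem_checkGates {r : ℕ} {c : ι ⊕ κ} {a : ℕ × Gate (Qubit ι κ D)} :
    a ∈ S.checkGates r c ↔ a = (S.begin r + S.prep c, .prep (checkBasis c) (.inr c))
      ∨ (∃ j ∈ C.support c, a = (S.begin r + S.cnot c j, checkCnot c j))
      ∨ a = (S.begin r + S.meas c, .meas (checkBasis c) (.inr c)) := by
  simp only [checkGates, Finset.mem_union, Finset.mem_singleton, Finset.mem_image, or_assoc,
    eq_comm (b := a)]

theorem actsOn_ancilla_of_mem_checkGates {r : ℕ} {c c' : ι ⊕ κ} {a : ℕ × Gate (Qubit ι κ D)}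
    (ha : a ∈ S.checkGates r c) : a.2.ActsOn (.inr c') ↔ c = c' := by
  obtain rfl | ⟨j, -, rfl⟩ | rfl := mem_checkGates.1 ha
  · exact Sum.inr_injective.eq_iff
  · exact checkCnot_actsOn_ancilla
  · exact Sum.inr_injective.eq_iff

theorem begin_eq_of_mem_checkGates {r s : ℕ} {c : ι ⊕ κ} {a : ℕ × Gate (Qubit ι κ D)}
    (hr : a ∈ S.checkGates r c) (hs : a ∈ S.checkGates s c) : S.begin r = S.begin s := by
  obtain rfl | ⟨j, -, rfl⟩ | rfl := mem_checkGates.1 hr <;>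
    obtain h | ⟨j', -, h⟩ | h := mem_checkGates.1 hs <;> obtain ⟨ht, hg⟩ := Prod.mk.inj h
  all_goals first
    | exact Nat.add_right_cancel ht
    | exact absurd hg (checkCnot_ne_prep _ _ _ _)
    | exact absurd hg (checkCnot_ne_meas _ _ _ _)
    | exact absurd hg.symm (checkCnot_ne_prep _ _ _ _)
    | exact absurd hg.symm (checkCnot_ne_meas _ _ _ _)
    | cases hg
    | exact Nat.add_right_cancel (checkCnot_injective c hg ▸ ht)

theorem mem_Icc_of_mem_checkGates {r : ℕ} {c : ι ⊕ κ} (hc : S.prep c ≤ S.meas c)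
    {a : ℕ × Gate (Qubit ι κ D)} (ha : a ∈ S.checkGates r c) :
    a.1 ∈ Finset.Icc (S.begin r + S.prep c) (S.begin r + S.meas c) := by
  rw [Finset.mem_Icc]
  obtain rfl | ⟨j, hj, rfl⟩ | rfl := mem_checkGates.1 ha
  · exact ⟨le_rfl, Nat.add_le_add_left hc _⟩
  · exact ⟨Nat.add_le_add_left (S.prep_lt_cnot c j hj).le _,
      Nat.add_le_add_left (S.cnot_lt_meas c j hj).le _⟩
  · exact ⟨Nat.add_le_add_left hc _, le_rfl⟩

theorem sum_checkGates {M : Type*} [AddCommMonoid M] (r : ℕ) (c : ι ⊕ κ)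
    (φ : ℕ × Gate (Qubit ι κ D) → M) :
    ∑ a ∈ S.checkGates r c, φ a = φ (S.begin r + S.prep c, .prep (checkBasis c) (.inr c))
      + ∑ j ∈ C.support c, φ (S.begin r + S.cnot c j, checkCnot c j)
      + φ (S.begin r + S.meas c, .meas (checkBasis c) (.inr c)) := by
  rw [checkGates, Finset.sum_union, Finset.sum_union, Finset.sum_singleton, Finset.sum_singleton,
    Finset.sum_image fun j _ j' _ h => checkCnot_injective c (Prod.mk.inj h).2]
  · simp [checkCnot_ne_prep]
  · simp [checkCnot_ne_meas]

variable [Fintype ι] [Fintype κ]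

theorem sum_memory {M : Type*} [AddCommMonoid M] (hstart : StrictMono S.start) (b : Basis) (m : ℕ)
    (φ : ℕ × Gate (Qubit ι κ D) → M) :
    ∑ a ∈ S.memory b m, φ a = ∑ j, φ (0, .prep b (.inl j))
      + ∑ r ∈ Finset.range m, ∑ c, ∑ a ∈ S.checkGates r c, φ a
      + ∑ j, φ (S.readoutTime m, .meas b (.inl j)) := by
  have hmemory : S.memory b m = (Finset.univ.image fun j => (0, .prep b (.inl j)))
      ∪ ((Finset.range m).biUnion fun r => Finset.univ.biUnion (S.checkGates r))
      ∪ (Finset.univ.image fun j => (S.readoutTime m, .meas b (.inl j))) := rfl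
  have hancilla : ∀ a ∈ (Finset.range m).biUnion fun r => Finset.univ.biUnion (S.checkGates r),
      ∃ c, a.2.ActsOn (.inr c) := by
    simp only [Finset.mem_biUnion, Finset.mem_univ, true_and]
    rintro a ⟨r, -, c, ha⟩
    exact ⟨c, (actsOn_ancilla_of_mem_checkGates ha).2 rfl⟩
  rw [hmemory, Finset.sum_union, Finset.sum_union, Finset.sum_image, Finset.sum_image,
    Finset.sum_biUnion]
  · congr 2
    refine Finset.sum_congr rfl fun r _ => Finset.sum_biUnion fun c _ c' _ hc => ?_
    exact Finset.disjoint_left.2 fun a ha ha' => hc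
      ((actsOn_ancilla_of_mem_checkGates ha').1 ((actsOn_ancilla_of_mem_checkGates ha).2 rfl)).symm
  · intro r _ s _ hrs
    simp only [Finset.disjoint_left, Finset.mem_biUnion, Finset.mem_univ, true_and]
    rintro a ⟨c, ha⟩ ⟨c', ha'⟩
    obtain rfl := (actsOn_ancilla_of_mem_checkGates ha').1
      ((actsOn_ancilla_of_mem_checkGates ha).2 rfl)
    exact hrs (hstart.injective (Nat.succ_injective (begin_eq_of_mem_checkGates ha ha')))
  · simp [Function.Injective]
  · simp [Function.Injective]
  · rw [Finset.disjoint_left]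
    intro a ha ha'
    obtain ⟨c, hc⟩ := hancilla a ha'
    obtain ⟨j, -, rfl⟩ := Finset.mem_image.1 ha
    exact Sum.inl_ne_inr hc
  · rw [Finset.disjoint_left]
    intro a ha ha'
    obtain ⟨j, -, rfl⟩ := Finset.mem_image.1 ha'
    obtain ha | ha := Finset.mem_union.1 ha
    · simp at ha
    · obtain ⟨c, hc⟩ := hancilla _ ha
      exact Sum.inl_ne_inr hc

theorem sum_memory_of_ancilla {M : Type*} [AddCommMonoid M] (hstart : StrictMono S.start)
    (b : Basis) (m : ℕ) {c : ι ⊕ κ} {φ : ℕ × Gate (Qubit ι κ D) → M}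
    (hφ : ∀ a, ¬ a.2.ActsOn (.inr c) → φ a = 0) :
    ∑ a ∈ S.memory b m, φ a = ∑ r ∈ Finset.range m, ∑ a ∈ S.checkGates r c, φ a := by
  rw [sum_memory hstart,
    Finset.sum_eq_zero fun j _ => hφ (0, .prep b (.inl j)) Sum.inl_ne_inr,
    Finset.sum_eq_zero fun j _ => hφ (S.readoutTime m, .meas b (.inl j)) Sum.inl_ne_inr,
    zero_add, add_zero]
  exact Finset.sum_congr rfl fun r _ => Finset.sum_eq_single_of_mem c (Finset.mem_univ c)
    fun c' _ hc => Finset.sum_eq_zero fun a ha =>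
      hφ a (mt (actsOn_ancilla_of_mem_checkGates ha).1 hc)

theorem sum_memory_of_data {M : Type*} [AddCommMonoid M] (hstart : StrictMono S.start)
    (b : Basis) (m : ℕ) {j : D} {φ : ℕ × Gate (Qubit ι κ D) → M}
    (hφ : ∀ a, ¬ a.2.ActsOn (.inl j) → φ a = 0) :
    ∑ a ∈ S.memory b m, φ a = φ (0, .prep b (.inl j))
      + ∑ r ∈ Finset.range m, ∑ c with j ∈ C.support c, φ (S.begin r + S.cnot c j, checkCnot c j)
      + φ (S.readoutTime m, .meas b (.inl j)) := by
  rw [sum_memory hstart,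
    Finset.sum_eq_single_of_mem j (Finset.mem_univ j)
      fun j' _ hj' => hφ (0, .prep b (.inl j')) (mt Sum.inl.inj hj'),
    Finset.sum_eq_single_of_mem j (Finset.mem_univ j)
      fun j' _ hj' => hφ (S.readoutTime m, .meas b (.inl j')) (mt Sum.inl.inj hj')]
  simp only [Finset.sum_filter]
  congr! 5 with r - c
  rw [sum_checkGates, hφ (_, .prep _ (.inr c)) Sum.inr_ne_inl,
    hφ (_, .meas _ (.inr c)) Sum.inr_ne_inl, zero_add, add_zero]
  split_ifs with hj
  · exact Finset.sum_eq_single_of_mem j hj fun j' _ hj' =>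
      hφ _ (mt checkCnot_actsOn_data.1 hj')
  · exact Finset.sum_eq_zero fun j' hj' =>
      hφ _ (mt checkCnot_actsOn_data.1 (ne_of_mem_of_not_mem hj' hj))

theorem frame_ancilla (b : Basis) {m r t : ℕ} (hr : r < m) {c : ι ⊕ κ}
    (E : Finset (Fault (Qubit ι κ D)))
    (hprep : S.begin r + S.prep c < t) (hmeas : t ≤ S.begin r + S.meas c) :
    frame (S.memory b m) E t (.inr c)
      = ∑ j ∈ C.support c with S.begin r + S.cnot c j < t,
          (checkCnot c j).kick (frame (S.memory b m) E (S.begin r + S.cnot c j)) (.inr c)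
        + ∑ u ∈ Finset.Ico (S.begin r + S.prep c) t, ∑ f ∈ E, f.error u (.inr c) := by
  have hc : S.prep c < S.meas c := by lia
  have hround : ∀ r', r' ≠ r → ∀ a ∈ S.checkGates r' c,
      a.1 ∉ Finset.Ico (S.begin r + S.prep c) t := fun r' hr' a ha h => by
    have hIcc := Finset.mem_Icc.1 (mem_Icc_of_mem_checkGates hc.le ha)
    have hIco := Finset.mem_Ico.1 h
    obtain hlt | hlt := hr'.lt_or_gt
    · have := S.round_ancilla r' r hlt c
      simp only [begin] at *
      lia
    · have := S.round_ancilla r r' hlt c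
      simp only [begin] at *
      lia
  have hcnot : ∀ j ∈ C.support c, S.begin r + S.cnot c j ∈ Finset.Ico (S.begin r + S.prep c) t ↔
      S.begin r + S.cnot c j < t := fun j hj =>
    Finset.mem_Ico.trans (and_iff_right (Nat.add_le_add_left (S.prep_lt_cnot c j hj).le _))
  rw [frame_eq_frame_add_sum _ _ hprep.le, Finset.sum_filter,
    sum_memory_of_ancilla (S.strictMono_start hc) b m (c := c)
      fun a ha => by rw [Gate.kick_eq_zero_of_not_actsOn ha, ite_self],
    Finset.sum_eq_single_of_mem r (Finset.mem_range.2 hr)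
      fun r' _ hr' => Finset.sum_eq_zero fun a ha => if_neg (hround r' hr' a ha),
    sum_checkGates, if_pos (Finset.left_mem_Ico.2 hprep),
    Finset.sum_congr rfl fun j hj => if_congr (hcnot j hj) rfl rfl,
    ← Finset.sum_filter]
  simp [Gate.kick]

theorem frame_data (hstart : StrictMono S.start) (b : Basis) (m t : ℕ) (j : D)
    (E : Finset (Fault (Qubit ι κ D))) :
    frame (S.memory b m) E t (.inl j)
      = ∑ r ∈ Finset.range m, ∑ c with j ∈ C.support c ∧ S.begin r + S.cnot c j < t,
          (checkCnot c j).kick (frame (S.memory b m) E (S.begin r + S.cnot c j)) (.inl j)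
        + ∑ u ∈ Finset.range t, ∑ f ∈ E, f.error u (.inl j) := by
  rw [frame_eq_frame_add_sum _ _ t.zero_le, Finset.sum_filter,
    sum_memory_of_data hstart b m (j := j)
      fun a ha => by rw [Gate.kick_eq_zero_of_not_actsOn ha, ite_self]]
  simp [frame, Gate.kick, Finset.sum_filter, ite_and]

end SEC

end Memory

section CnotXFaults

variable {ι κ D : Type}

section

variable [Fintype D] {C : CSSCode ι κ D}

theorem ite_eq_one_eq_mul (a b : ZMod 2) : (if a = 1 then b else 0) = a * b := by
  decide +revert

theorem CSSCode.sum_support_inl (C : CSSCode ι κ D) (i : ι) (e : D → ZMod 2) :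
    ∑ j ∈ C.support (.inl i), e j = C.HX.mulVec e i := by
  simp only [support, Finset.sum_filter, ite_eq_one_eq_mul]
  rfl

theorem CSSCode.sum_support_inr (C : CSSCode ι κ D) (k : κ) (e : D → ZMod 2) :
    ∑ j ∈ C.support (.inr k), e j = C.HZ.mulVec e k := by
  simp only [support, Finset.sum_filter, ite_eq_one_eq_mul]
  rfl

variable [DecidableEq D] {S : SEC C}

theorem SEC.begin_add_cnot_lt (S : SEC C) {r s : ℕ} (hrs : r < s) {c c' : ι ⊕ κ} {j : D}
    (hj : j ∈ C.support c) (hj' : j ∈ C.support c') :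
    S.begin r + S.cnot c j < S.begin s + S.cnot c' j := by
  have := S.round_data r s hrs c c' j hj hj'
  simp only [begin]
  lia

theorem SEC.NonInterleaved.forall_cnot_lt_or (hS : S.NonInterleaved) (r : ℕ) :
    (∀ i k j, j ∈ C.support (.inl i) → j ∈ C.support (.inr k) →
      S.begin 0 + S.cnot (.inl i) j < S.begin r + S.cnot (.inr k) j) ∨
    (∀ i k j, j ∈ C.support (.inl i) → j ∈ C.support (.inr k) →
      ¬ S.begin 0 + S.cnot (.inl i) j < S.begin r + S.cnot (.inr k) j) := by
  obtain rfl | hr := r.eq_zero_or_pos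
  · exact hS.imp (fun h i k j hi hk => Nat.add_lt_add_left (h i k j hi hk) _)
      fun h i k j hi hk => (Nat.add_lt_add_left (h i k j hi hk) _).not_gt
  · exact .inl fun i k j hi hk => S.begin_add_cnot_lt hr hi hk

theorem SEC.begin_add_meas_lt_readoutTime [Fintype ι] [Fintype κ] (S : SEC C) {r m : ℕ}
    (hr : r < m) (c : ι ⊕ κ) : S.begin r + S.meas c < S.readoutTime m := by
  rw [readoutTime, Nat.lt_succ_iff]
  exact (Finset.le_sup (f := fun c => S.begin r + S.meas c) (Finset.mem_univ c)).trans
    (Finset.le_sup (f := fun r => Finset.univ.sup fun c => S.begin r + S.meas c)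
      (Finset.mem_range.2 hr))

end

/-- An `X`-type Pauli error directly after a CNOT of an `X` check in the first round:
`X ^ ancillaX` on the ancilla of the check `check` and `X ^ dataX` on the data qubit `data`. -/
structure CnotXFault (ι D : Type) where
  check : ι
  data : D
  ancillaX : ZMod 2
  dataX : ZMod 2
  deriving DecidableEq

namespace CnotXFault

section

variable [Fintype D] [DecidableEq D]

/-- The fault is a non-identity Pauli error after a CNOT that the circuit contains. -/
structure IsValid (C : CSSCode ι κ D) (f : CnotXFault ι D) : Prop where
  data_mem : f.data ∈ C.support (.inl f.check)
  ne_zero : f.ancillaX ≠ 0 ∨ f.dataX ≠ 0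

variable {C : CSSCode ι κ D}

/-- The error mechanism of the memory experiment that the fault stands for. -/
def toFault (S : SEC C) (f : CnotXFault ι D) : Fault (Qubit ι κ D) :=
  .cnotPauli (S.begin 0 + S.cnot (.inl f.check) f.data) (.inr (.inl f.check)) (.inl f.data)
    (f.ancillaX, 0) (f.dataX, 0)

/-- The `X` error that the fault leaves on the data qubits: besides `data` itself, the ancilla
spreads its error to the data qubits with which it has yet to interact. -/
def residual (S : SEC C) (f : CnotXFault ι D) (j : D) : ZMod 2 :=
  (if j ∈ C.support (.inl f.check) ∧ S.cnot (.inl f.check) f.data < S.cnot (.inl f.check) j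
    then f.ancillaX else 0) + if j = f.data then f.dataX else 0

theorem toFault_injective (S : SEC C) : Function.Injective (toFault S) := by
  rintro ⟨i, j, a, b⟩ ⟨i', j', a', b'⟩ h
  simp only [toFault, Fault.cnotPauli.injEq, Sum.inr.injEq, Sum.inl.injEq, Prod.mk.injEq] at h
  simp [h]

/-- The error configuration that consists of the given faults. -/
def faults (S : SEC C) (E : Finset (CnotXFault ι D)) : Finset (Fault (Qubit ι κ D)) :=
  E.map ⟨toFault S, toFault_injective S⟩

theorem residual_eq_zero {S : SEC C} {f : CnotXFault ι D} (hf : f.IsValid C) {j : D}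
    (hj : j ∉ C.support (.inl f.check)) : f.residual S j = 0 := by
  rw [residual, if_neg fun h => hj h.1, if_neg (ne_of_mem_of_not_mem hf.data_mem hj).symm, add_zero]

variable [DecidableEq ι] [DecidableEq κ]

theorem readout_toFault (S : SEC C) (f : CnotXFault ι D) (t : ℕ) (b : Basis)
    (q : Qubit ι κ D) : (f.toFault S).readout t b q = 0 :=
  rfl

theorem error_toFault_snd (S : SEC C) (f : CnotXFault ι D) (t : ℕ) (q : Qubit ι κ D) :
    ((f.toFault S).error t q).2 = 0 := by
  simp only [toFault, Fault.error]
  split_ifs <;> rfl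

theorem sum_error_toFault_ancilla (S : SEC C) (f : CnotXFault ι D) (s : Finset ℕ) (c : ι ⊕ κ) :
    ∑ t ∈ s, (f.toFault S).error t (.inr c) =
      if S.begin 0 + S.cnot (.inl f.check) f.data ∈ s ∧ c = .inl f.check
        then (f.ancillaX, 0) else 0 := by
  by_cases hc : c = .inl f.check <;> simp [toFault, Fault.error, hc]

theorem sum_error_toFault_data (S : SEC C) (f : CnotXFault ι D) (s : Finset ℕ) (j : D) :
    ∑ t ∈ s, (f.toFault S).error t (.inl j) =
      if S.begin 0 + S.cnot (.inl f.check) f.data ∈ s ∧ j = f.data then (f.dataX, 0) else 0 := by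
  by_cases hj : j = f.data <;> simp [toFault, Fault.error, hj]

theorem outcomeFlip_faults (B : Circuit (Qubit ι κ D)) (S : SEC C) (E : Finset (CnotXFault ι D))
    (t : ℕ) (b : Basis) (q : Qubit ι κ D) :
    outcomeFlip B (faults S E) t b q = ∑ f ∈ E, b.detects (frame B {f.toFault S} t q) := by
  rw [outcomeFlip_eq_sum_singleton, faults, Finset.sum_map]
  simp [outcomeFlip, readout_toFault]

variable [Fintype ι] [Fintype κ] {S : SEC C} {f : CnotXFault ι D} {m : ℕ}

theorem frame_xAncilla (hf : f.IsValid C) (b : Basis) {r : ℕ} (hr : r < m) {i : ι} {j : D}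
    (hj : j ∈ C.support (.inl i)) :
    (frame (S.memory b m) {f.toFault S} (S.begin r + S.cnot (.inl i) j) (.inr (.inl i))).1 =
      if i = f.check ∧ r = 0 ∧ S.cnot (.inl i) f.data < S.cnot (.inl i) j
        then f.ancillaX else 0 := by
  rw [SEC.frame_ancilla b hr _ (Nat.add_lt_add_left (S.prep_lt_cnot _ j hj) _)
    (Nat.add_le_add_left (S.cnot_lt_meas _ j hj).le _)]
  have hmem : S.begin 0 + S.cnot (.inl f.check) f.data ∈
      Finset.Ico (S.begin r + S.prep (.inl i)) (S.begin r + S.cnot (.inl i) j) ∧ i = f.check ↔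
      i = f.check ∧ r = 0 ∧ S.cnot (.inl i) f.data < S.cnot (.inl i) j := by
    rw [and_comm]
    refine and_congr_right ?_
    rintro rfl
    have hprep := S.prep_lt_cnot _ _ hf.data_mem
    have hmeas := S.cnot_lt_meas _ _ hf.data_mem
    obtain rfl | hr := r.eq_zero_or_pos
    · simp [hprep.le]
    · have := S.round_ancilla 0 r hr (.inl f.check)
      simp only [SEC.begin, Finset.mem_Ico]
      lia
  simp only [Finset.sum_singleton, sum_error_toFault_ancilla, checkCnot, Gate.kick, Prod.fst_add,
    Prod.fst_sum, Sum.inl.injEq, reduceCtorEq, if_false, Finset.sum_const_zero, zero_add,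
    apply_ite Prod.fst, Prod.fst_zero, hmem]

theorem frame_data (hf : f.IsValid C) (b : Basis) (hm : 0 < m) (t : ℕ) (j : D) :
    (frame (S.memory b m) {f.toFault S} t (.inl j)).1 =
      if S.begin 0 + S.cnot (.inl f.check) j < t then f.residual S j else 0 := by
  have hstart : StrictMono S.start := S.strictMono_start (c := .inl f.check)
    ((S.prep_lt_cnot _ _ hf.data_mem).trans (S.cnot_lt_meas _ _ hf.data_mem))
  have hkick : ∀ r ∈ Finset.range m, ∀ c, j ∈ C.support c →
      ((checkCnot c j).kick (frame (S.memory b m) {f.toFault S} (S.begin r + S.cnot c j))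
        (.inl j)).1 = if c = .inl f.check ∧ r = 0 ∧ S.cnot c f.data < S.cnot c j
          then f.ancillaX else 0 := by
    rintro r hr (i | k) hj
    · simp [checkCnot, Gate.kick, frame_xAncilla hf b (Finset.mem_range.1 hr) hj]
    · simp [checkCnot, Gate.kick]
  have hspread : ∑ r ∈ Finset.range m, ∑ c with j ∈ C.support c ∧ S.begin r + S.cnot c j < t,
      ((checkCnot c j).kick (frame (S.memory b m) {f.toFault S} (S.begin r + S.cnot c j))
        (.inl j)).1 = if S.begin 0 + S.cnot (.inl f.check) j < t then
          if j ∈ C.support (.inl f.check) ∧ S.cnot (.inl f.check) f.data < S.cnot (.inl f.check) j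
            then f.ancillaX else 0 else 0 := by
    rw [Finset.sum_congr rfl fun r hr => Finset.sum_congr rfl fun c hc =>
        hkick r hr c (Finset.mem_filter.1 hc).2.1,
      Finset.sum_eq_single_of_mem 0 (Finset.mem_range.2 hm)
        fun r _ hr => Finset.sum_eq_zero fun c _ => if_neg fun h => hr h.2.1,
      Finset.sum_filter, Finset.sum_eq_single_of_mem (.inl f.check) (Finset.mem_univ _)
        fun c _ hc => by simp [hc]]
    by_cases hj : j ∈ C.support (.inl f.check) <;> simp [hj]
  rw [SEC.frame_data hstart, Prod.fst_add, Prod.fst_sum]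
  simp only [Prod.fst_sum, hspread, Finset.sum_singleton, sum_error_toFault_data,
    apply_ite Prod.fst, Prod.fst_zero, Finset.mem_range, residual]
  by_cases hj : j = f.data
  · subst hj
    split_ifs <;> simp_all
  · simp [hj]

theorem frame_zAncilla (hf : f.IsValid C) (b : Basis) (hm : 0 < m) {r : ℕ} (hr : r < m) {k : κ}
    (hk : (C.support (.inr k)).Nonempty) :
    (frame (S.memory b m) {f.toFault S} (S.begin r + S.meas (.inr k)) (.inr (.inr k))).1 =
      ∑ j ∈ C.support (.inr k),
        if S.begin 0 + S.cnot (.inl f.check) j < S.begin r + S.cnot (.inr k) j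
          then f.residual S j else 0 := by
  obtain ⟨j, hj⟩ := hk
  have hmeas : ∀ j ∈ C.support (.inr k),
      S.begin r + S.cnot (.inr k) j < S.begin r + S.meas (.inr k) := fun j hj =>
    Nat.add_lt_add_left (S.cnot_lt_meas _ j hj) _
  rw [SEC.frame_ancilla b hr _ ((Nat.add_lt_add_left (S.prep_lt_cnot _ j hj) _).trans (hmeas j hj))
    le_rfl, Finset.filter_true_of_mem hmeas]
  simp [sum_error_toFault_ancilla, checkCnot, Gate.kick, Prod.fst_sum, frame_data hf b hm]

variable {E : Finset (CnotXFault ι D)}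

theorem isConfiguration_faults (hE : ∀ f ∈ E, f.IsValid C) (b : Basis) (hm : 0 < m)
    (noisyBoundary : Bool) : S.IsConfiguration b m noisyBoundary (faults S E) := by
  simp only [SEC.IsConfiguration, faults, Finset.forall_mem_map]
  intro f hf
  refine ⟨⟨?_, ?_⟩, .inr id⟩
  · simp only [SEC.memory, Finset.mem_union, Finset.mem_biUnion]
    exact .inl (.inr ⟨0, Finset.mem_range.2 hm, .inl f.check, Finset.mem_univ _,
      .inl (.inr (Finset.mem_image.2 ⟨f.data, (hE f hf).data_mem, rfl⟩))⟩)
  · have := (hE f hf).ne_zero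
    simpa [Prod.ext_iff, or_iff_not_imp_left] using this

theorem checkFlip_inl (S : SEC C) (E : Finset (CnotXFault ι D)) (b : Basis) (m r : ℕ) (i : ι) :
    S.checkFlip b m (faults S E) r (.inl i) = 0 := by
  rw [SEC.checkFlip, outcomeFlip_faults]
  exact Finset.sum_eq_zero fun f _ => frame_snd_eq_zero _
    (by simp only [Finset.mem_singleton, forall_eq, error_toFault_snd, implies_true]) _ _

theorem dataFlip_eq (hE : ∀ f ∈ E, f.IsValid C) (hm : 0 < m) (j : D) :
    S.dataFlip .Z m (faults S E) j = (∑ f ∈ E, f.residual S) j := by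
  rw [SEC.dataFlip, outcomeFlip_faults, Finset.sum_apply]
  refine Finset.sum_congr rfl fun f hf => ?_
  rw [Basis.detects, frame_data (hE f hf) _ hm]
  split_ifs with h
  · rfl
  · refine (residual_eq_zero (hE f hf) fun hj => h ?_).symm
    have := S.cnot_lt_meas _ _ hj
    have := S.begin_add_meas_lt_readoutTime hm (.inl f.check)
    lia

theorem checkFlip_inr (hS : S.NonInterleaved) (hE : ∀ f ∈ E, f.IsValid C)
    (he : C.HZ.mulVec (∑ f ∈ E, f.residual S) = 0) (b : Basis) {r : ℕ} (hr : r < m)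
    {k : κ} (hk : (C.support (.inr k)).Nonempty) :
    S.checkFlip b m (faults S E) r (.inr k) = 0 := by
  have hsum : S.checkFlip b m (faults S E) r (.inr k) = ∑ f ∈ E, ∑ j ∈ C.support (.inr k),
      if S.begin 0 + S.cnot (.inl f.check) j < S.begin r + S.cnot (.inr k) j
        then f.residual S j else 0 := by
    rw [SEC.checkFlip, outcomeFlip_faults]
    exact Finset.sum_congr rfl fun f hf => frame_zAncilla (hE f hf) b (r.zero_le.trans_lt hr) hr hk
  rw [hsum]
  obtain h | h := hS.forall_cnot_lt_or r
  · have hbefore : ∀ f ∈ E, ∀ j ∈ C.support (.inr k),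
        (if S.begin 0 + S.cnot (.inl f.check) j < S.begin r + S.cnot (.inr k) j
          then f.residual S j else 0) = f.residual S j := fun f hf j hj =>
      ite_eq_left_iff.2 fun hlt => (residual_eq_zero (hE f hf) fun hi => hlt (h _ k j hi hj)).symm
    rw [Finset.sum_congr rfl fun f hf => Finset.sum_congr rfl (hbefore f hf), Finset.sum_comm]
    simp only [← Finset.sum_apply, C.sum_support_inr, he, Pi.zero_apply]
  · refine Finset.sum_eq_zero fun f hf => Finset.sum_eq_zero fun j hj => ite_eq_right_iff.2 ?_
    exact fun hlt => residual_eq_zero (hE f hf) fun hi => h _ k j hi hj hlt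

end

end CnotXFault

end CnotXFaults

section CausesXError

theorem dotProduct_eq_zero_of_mem_span_row {ι D R : Type*} [Fintype D] [CommSemiring R]
    {A : Matrix ι D R} {e v : D → R} (he : A.mulVec e = 0)
    (hv : v ∈ Submodule.span R (Set.range A.row)) : v ⬝ᵥ e = 0 := by
  induction hv using Submodule.span_induction with
  | mem x hx =>
    obtain ⟨i, rfl⟩ := hx
    exact congrFun he i
  | zero => exact zero_dotProduct e
  | add x y _ _ hx hy => rw [add_dotProduct, hx, hy, add_zero]
  | smul a x _ hx => rw [smul_dotProduct, hx, smul_zero]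

theorem CSSCode.HZ_mulVec_eq_zero_of_mem_span_row {ι κ D : Type} [Fintype D] (C : CSSCode ι κ D)
    {e : D → ZMod 2} (he : e ∈ Submodule.span (ZMod 2) (Set.range C.HX.row)) :
    C.HZ.mulVec e = 0 := by
  funext k
  have hk : C.HX.mulVec (C.HZ.row k) = 0 := funext fun i => congrFun (congrFun C.comm i) k
  exact (dotProduct_comm _ _).trans (dotProduct_eq_zero_of_mem_span_row hk he)

theorem sum_symmDiff {α M : Type*} [DecidableEq α] [AddCommGroup M] [Module (ZMod 2) M]
    (s t : Finset α) (φ : α → M) : ∑ a ∈ symmDiff s t, φ a = ∑ a ∈ s, φ a + ∑ a ∈ t, φ a := by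
  have hs := Finset.sum_inter_add_sum_sdiff s t φ
  have ht := Finset.sum_inter_add_sum_sdiff t s φ
  rw [Finset.inter_comm] at ht
  rw [symmDiff_def, Finset.sup_eq_union, Finset.sum_union disjoint_sdiff_sdiff, ← hs, ← ht,
    add_add_add_comm, ZModModule.add_self, zero_add]

theorem card_symmDiff_le {α : Type*} [DecidableEq α] (s t : Finset α) :
    (symmDiff s t).card ≤ s.card + t.card :=
  (Finset.card_union_le _ _).trans
    (add_le_add (Finset.card_le_card Finset.sdiff_subset) (Finset.card_le_card Finset.sdiff_subset))

namespace SEC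

variable {ι κ D : Type} [Fintype D] [DecidableEq D] {C : CSSCode ι κ D}

/-- At most `n` faults after CNOTs of `X` checks in the first round can leave the `X` error `e` on
the data qubits, up to `X` checks, which act trivially on the code. -/
def CausesXError (S : SEC C) (n : ℕ) (e : D → ZMod 2) : Prop :=
  ∃ E : Finset (CnotXFault ι D), (∀ f ∈ E, f.IsValid C) ∧ E.card ≤ n ∧
    e - ∑ f ∈ E, f.residual S ∈ Submodule.span (ZMod 2) (Set.range C.HX.row)

variable {S : SEC C}

namespace CausesXError

theorem zero : S.CausesXError 0 0 :=
  ⟨∅, by simp⟩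

theorem add {n n' : ℕ} {e e' : D → ZMod 2} (h : S.CausesXError n e)
    (h' : S.CausesXError n' e') : S.CausesXError (n + n') (e + e') := by
  obtain ⟨E, hE, hcard, he⟩ := h
  obtain ⟨E', hE', hcard', he'⟩ := h'
  classical
  -- a fault that occurs in both configurations cancels
  refine ⟨symmDiff E E', fun f hf => ?_,
    (card_symmDiff_le E E').trans (add_le_add hcard hcard'), ?_⟩
  · obtain hf | hf := Finset.mem_symmDiff.1 hf
    exacts [hE f hf.1, hE' f hf.1]
  · rw [sum_symmDiff, add_sub_add_comm]
    exact add_mem he he'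

theorem list_sum {α : Type*} {n : ℕ} {e : α → D → ZMod 2} {L : List α}
    (h : ∀ a ∈ L, S.CausesXError n (e a)) :
    S.CausesXError (L.length * n) (L.map e).sum := by
  induction L with
  | nil => simpa using zero
  | cons a L ih =>
    rw [List.map_cons, List.sum_cons, List.length_cons, Nat.succ_mul, add_comm (_ * n)]
    exact (h a List.mem_cons_self).add (ih fun b hb => h b (List.mem_cons_of_mem a hb))

theorem of_residual {f : CnotXFault ι D} (hf : f.IsValid C) :
    S.CausesXError 1 (f.residual S) :=
  ⟨{f}, by simpa using hf, by simp⟩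

theorem of_add_mem_span {n : ℕ} {e e' : D → ZMod 2} (h : S.CausesXError n e)
    (he : e + e' ∈ Submodule.span (ZMod 2) (Set.range C.HX.row)) : S.CausesXError n e' := by
  obtain ⟨E, hE, hcard, hspan⟩ := h
  refine ⟨E, hE, hcard, ?_⟩
  have heq : e' - ∑ f ∈ E, f.residual S =
      (e - ∑ f ∈ E, f.residual S) + (e + e') - (e + e) := by abel
  rw [heq, ZModModule.add_self e, sub_zero]
  exact add_mem hspan he

theorem single {i : ι} {j : D} (hj : j ∈ C.support (.inl i)) :
    S.CausesXError 1 (Pi.single j 1) := by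
  convert of_residual (S := S) (f := ⟨i, j, 0, 1⟩) ⟨hj, .inr one_ne_zero⟩ using 1
  funext j'
  simp [CnotXFault.residual, Pi.single_apply]

theorem tail {i : ι} {j : D} (hj : j ∈ C.support (.inl i)) :
    S.CausesXError 1 (∑ j' ∈ C.support (.inl i) with S.cnot (.inl i) j < S.cnot (.inl i) j',
      Pi.single j' 1) := by
  convert of_residual (S := S) (f := ⟨i, j, 1, 0⟩) ⟨hj, .inl one_ne_zero⟩ using 1
  funext j'
  simp [CnotXFault.residual, Finset.sum_apply, Pi.single_apply]

theorem head {i : ι} {j : D} (hj : j ∈ C.support (.inl i)) :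
    S.CausesXError 1 (∑ j' ∈ C.support (.inl i) with ¬ S.cnot (.inl i) j < S.cnot (.inl i) j',
      Pi.single j' 1) := by
  -- together with the `tail` error, this one is the whole check
  refine (tail hj).of_add_mem_span ?_
  rw [Finset.sum_filter_add_sum_filter_not]
  refine Submodule.subset_span ⟨i, funext fun j' => ?_⟩
  have hrow := C.sum_support_inl i (Pi.single j' 1)
  rw [Matrix.mulVec_single_one] at hrow
  rw [Finset.sum_apply]
  simp only [Pi.single_comm]
  exact hrow.symm

end CausesXError

variable [DecidableEq ι] [DecidableEq κ] [Fintype ι] [Fintype κ]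

theorem basisDistance_le_card (hS : S.NonInterleaved) {m : ℕ} (hm : 0 < m) (noisyBoundary : Bool)
    (hZ : ∀ k, (C.support (.inr k)).Nonempty) {E : Finset (CnotXFault ι D)}
    (hE : ∀ f ∈ E, f.IsValid C) (he : C.HZ.mulVec (∑ f ∈ E, f.residual S) = 0) {v : D → ZMod 2}
    (hv : C.HX.mulVec v = 0) (hve : v ⬝ᵥ ∑ f ∈ E, f.residual S = 1) :
    S.basisDistance m noisyBoundary .Z ≤ E.card := by
  have hcheck : ∀ r < m, ∀ c, S.checkFlip .Z m (CnotXFault.faults S E) r c = 0 := by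
    rintro r hr (i | k)
    · exact CnotXFault.checkFlip_inl S E .Z m r i
    · exact CnotXFault.checkFlip_inr hS hE he .Z hr (hZ k)
  refine sInf_le ⟨CnotXFault.faults S E, CnotXFault.isConfiguration_faults hE .Z hm noisyBoundary,
    ⟨fun r c hr => ?_, fun c _ _ => hcheck 0 hm c, ?_⟩, ⟨v, ⟨hv, fun hmem => ?_⟩, ?_⟩, ?_⟩
  · rw [hcheck r (Nat.lt_of_succ_lt hr), hcheck _ hr, add_zero]
  · rintro (i | k) hc -
    · cases hc
    · simp only [CnotXFault.dataFlip_eq hE hm, C.sum_support_inr, he, Pi.zero_apply, add_zero,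
        hcheck _ (Nat.sub_one_lt hm.ne')]
  · exact one_ne_zero (hve.symm.trans (dotProduct_eq_zero_of_mem_span_row he hmem))
  · simp only [CnotXFault.dataFlip_eq hE hm]
    exact hve
  · rw [CnotXFault.faults, Finset.card_map]

theorem CausesXError.basisDistance_le {n : ℕ} {e : D → ZMod 2} (h : S.CausesXError n e)
    (hS : S.NonInterleaved) {m : ℕ} (hm : 0 < m) (noisyBoundary : Bool)
    (hZ : ∀ k, (C.support (.inr k)).Nonempty) (he : C.HZ.mulVec e = 0) {v : D → ZMod 2}
    (hv : C.HX.mulVec v = 0) (hve : v ⬝ᵥ e = 1) : S.basisDistance m noisyBoundary .Z ≤ n := by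
  obtain ⟨E, hE, hcard, hspan⟩ := h
  have hHZ := C.HZ_mulVec_eq_zero_of_mem_span_row hspan
  have hdot := dotProduct_eq_zero_of_mem_span_row hv hspan
  rw [Matrix.mulVec_sub, he, zero_sub, neg_eq_zero] at hHZ
  rw [dotProduct_comm, dotProduct_sub, hve, sub_eq_zero] at hdot
  exact (basisDistance_le_card hS hm noisyBoundary hZ hE hHZ hv hdot.symm).trans
    (Nat.cast_le.2 hcard)

end SEC

end CausesXError

section ErrorOn

variable {D : Type*} [DecidableEq D]

/-- The `X` error on the data qubits in the list `L`, counted with multiplicity. -/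
def errorOn (L : List D) : D → ZMod 2 :=
  (L.map fun j => Pi.single j 1).sum

theorem errorOn_append (L L' : List D) : errorOn (L ++ L') = errorOn L + errorOn L' := by
  rw [errorOn, List.map_append, List.sum_append, errorOn, errorOn]

theorem dotProduct_errorOn [Fintype D] (y : D → ZMod 2) (L : List D) :
    y ⬝ᵥ errorOn L = (L.map y).sum := by
  induction L with
  | nil => exact dotProduct_zero y
  | cons j L ih =>
    rw [List.map_cons, List.sum_cons, ← ih, ← dotProduct_single_one y j, ← dotProduct_add]
    rfl

end ErrorOn

section GrossCode

/-- The embedding of `Fin 6` onto the data qubits of the `X` check `g` of the gross code that is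
compatible with translations: the terms of `A` come first, then those of `B`. -/
def port (g : GrossGroup) : Fin 6 ↪ GrossGroup ⊕ GrossGroup where
  toFun l := shiftData g
    (![.inl (3, 0), .inl (0, 1), .inl (0, 2), .inr (0, 3), .inr (1, 0), .inr (2, 0)] l)
  inj' := (Sum.map_injective.2 ⟨add_right_injective g, add_right_injective g⟩).comp (by decide)

theorem shiftData_port_zero (g : GrossGroup) (l : Fin 6) : shiftData g (port 0 l) = port g l := by
  simp [port, shiftData, Function.comp_def]

theorem grossCode_support_inl (g : GrossGroup) :
    grossCode.support (.inl g) = Finset.univ.map (port g) := by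
  ext j
  rw [CSSCode.support, Finset.mem_filter, Finset.mem_map]
  cases j <;> simp [grossCode, shiftMatrix, grossA, grossB, port, shiftData, Fin.exists_fin_succ,
    sub_eq_iff_eq_add', eq_comm, or_iff_not_imp_left]

theorem port_mem_support (g : GrossGroup) (l : Fin 6) :
    port g l ∈ grossCode.support (.inl g) := by
  rw [grossCode_support_inl]
  exact Finset.mem_map_of_mem _ (Finset.mem_univ l)

theorem exists_mem_grossCode_support_inl (j : GrossGroup ⊕ GrossGroup) :
    ∃ g, j ∈ grossCode.support (.inl g) := by
  obtain h | h := j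
  · exact ⟨h - (3, 0), by simp [CSSCode.support, grossCode, shiftMatrix, grossA]⟩
  · exact ⟨h - (0, 3), by simp [CSSCode.support, grossCode, shiftMatrix, grossB]⟩

theorem grossCode_support_inr_nonempty (g : GrossGroup) :
    (grossCode.support (.inr g)).Nonempty :=
  ⟨.inl (g - (1, 0)), by simp [CSSCode.support, grossCode, shiftMatrix, grossB]⟩

variable {S : SEC grossCode}

theorem UniformlyTiled.exists_perm_strictMono (hU : UniformlyTiled S) :
    ∃ σ : Equiv.Perm (Fin 6), ∀ g, StrictMono fun l => S.cnot (.inl g) (port g (σ l)) := by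
  set τ : Fin 6 → ℕ := fun l => S.cnot (.inl 0) (port 0 l)
  have hinj : Function.Injective τ := fun l l' h => by
    by_contra hne
    exact S.cnot_ne_of_check (.inl 0) _ (port_mem_support 0 l) _ (port_mem_support 0 l')
      ((port 0).injective.ne hne) h
  have hsort : StrictMono (τ ∘ Tuple.sort τ) :=
    (Tuple.monotone_sort τ).strictMono_of_injective (hinj.comp (Tuple.sort τ).injective)
  refine ⟨Tuple.sort τ, fun g l l' hl => ?_⟩
  have htile := hU 0 g _ (port_mem_support 0 (Tuple.sort τ l)) _
    (port_mem_support 0 (Tuple.sort τ l'))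
  rw [add_zero, shiftData_port_zero, shiftData_port_zero] at htile
  exact htile.1 (hsort hl)

/-- In each `X` check, a single fault can leave an `X` error on exactly the data qubits at the
ports in `s`, up to `X` checks. -/
def IsHook (S : SEC grossCode) (s : Finset (Fin 6)) : Prop :=
  ∀ g, S.CausesXError 1 (∑ l ∈ s, Pi.single (port g l) 1)

theorem sum_grossCode_support_inl_filter {M : Type*} [AddCommMonoid M] (σ : Equiv.Perm (Fin 6))
    (g : GrossGroup) (p : GrossGroup ⊕ GrossGroup → Prop) [DecidablePred p] (s : Finset (Fin 6))
    (hs : ∀ l, p (port g (σ l)) ↔ l ∈ s) (φ : GrossGroup ⊕ GrossGroup → M) :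
    ∑ j ∈ grossCode.support (.inl g) with p j, φ j =
      ∑ l ∈ s.map σ.toEmbedding, φ (port g l) := by
  rw [Finset.sum_filter, grossCode_support_inl, Finset.sum_map, Finset.sum_map,
    ← Equiv.sum_comp σ]
  simp only [hs, Finset.sum_ite_mem, Finset.univ_inter, Equiv.coe_toEmbedding]

section

variable {σ : Equiv.Perm (Fin 6)}

theorem IsHook.map_Ioi (hσ : ∀ g, StrictMono fun l => S.cnot (.inl g) (port g (σ l))) (k : Fin 6) :
    IsHook S ((Finset.Ioi k).map σ.toEmbedding) := fun g => by
  have hsum := sum_grossCode_support_inl_filter σ g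
    (fun j => S.cnot (.inl g) (port g (σ k)) < S.cnot (.inl g) j) (Finset.Ioi k)
    (fun l => (hσ g).lt_iff_lt.trans Finset.mem_Ioi.symm) (fun j => Pi.single j (1 : ZMod 2))
  exact hsum ▸ .tail (port_mem_support g (σ k))

theorem IsHook.map_Iic (hσ : ∀ g, StrictMono fun l => S.cnot (.inl g) (port g (σ l))) (k : Fin 6) :
    IsHook S ((Finset.Iic k).map σ.toEmbedding) := fun g => by
  have hsum := sum_grossCode_support_inl_filter σ g
    (fun j => ¬ S.cnot (.inl g) (port g (σ k)) < S.cnot (.inl g) j) (Finset.Iic k)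
    (fun l => ((hσ g).lt_iff_lt.not.trans not_lt).trans Finset.mem_Iic.symm)
    (fun j => Pi.single j (1 : ZMod 2))
  exact hsum ▸ .head (port_mem_support g (σ k))

end

theorem causesXError_errorOn (L : List (GrossGroup ⊕ GrossGroup)) :
    S.CausesXError L.length (errorOn L) := by
  have := SEC.CausesXError.list_sum (S := S) (n := 1) (e := fun j => Pi.single j 1) (L := L)
    fun j _ => (exists_mem_grossCode_support_inl j).elim fun _ => .single
  rwa [mul_one] at this

/-- The data qubits at the ports `l` and `l'` of the `X` checks in `H`. -/
def portPairs (l l' : Fin 6) (H : List GrossGroup) : List (GrossGroup ⊕ GrossGroup) :=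
  (H.map fun g => port g l) ++ H.map fun g => port g l'

theorem IsHook.causesXError_portPairs {l l' : Fin 6} (h : IsHook S {l, l'}) (hne : l ≠ l')
    (H : List GrossGroup) : S.CausesXError H.length (errorOn (portPairs l l' H)) := by
  have := SEC.CausesXError.list_sum (L := H) fun g _ => h g
  simp only [Finset.sum_pair hne, mul_one, List.sum_map_add] at this
  rwa [portPairs, errorOn_append, errorOn, errorOn, List.map_map, List.map_map]

/-- The support of a logical `Z` operator of the gross code. -/
def zLogical : List (GrossGroup ⊕ GrossGroup) :=
  [.inl (1, 3), .inl (1, 4), .inl (2, 2), .inl (4, 0), .inl (6, 4), .inl (6, 5), .inl (10, 5),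
    .inl (11, 4), .inr (1, 3), .inr (2, 3), .inr (3, 1), .inr (5, 5), .inr (6, 4), .inr (7, 2),
    .inr (7, 4), .inr (8, 1)]

theorem HX_mulVec_errorOn_zLogical : grossCode.HX.mulVec (errorOn zLogical) = 0 := by
  have h : ∀ g, (zLogical.map (grossCode.HX g)).sum = 0 := by decide +kernel
  exact funext fun g => (dotProduct_errorOn _ _).trans (h g)

/-- The `X` errors on `L` commute with the `Z` checks but not with `zLogical`. -/
def FlipsZLogical (L : List (GrossGroup ⊕ GrossGroup)) : Prop :=
  (∀ k, (L.map (grossCode.HZ k)).sum = 0) ∧ (L.map (errorOn zLogical)).sum = 1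

instance (L : List (GrossGroup ⊕ GrossGroup)) : Decidable (FlipsZLogical L) :=
  inferInstanceAs (Decidable (_ ∧ _))

theorem FlipsZLogical.basisDistance_le {L : List (GrossGroup ⊕ GrossGroup)} (hL : FlipsZLogical L)
    {n : ℕ} (h : S.CausesXError n (errorOn L)) (hS : S.NonInterleaved) {m : ℕ} (hm : 0 < m)
    (noisyBoundary : Bool) : S.basisDistance m noisyBoundary .Z ≤ n :=
  h.basisDistance_le hS hm noisyBoundary grossCode_support_inr_nonempty
    (funext fun k => (dotProduct_errorOn _ _).trans (hL.1 k)) HX_mulVec_errorOn_zLogical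
    ((dotProduct_errorOn _ _).trans hL.2)

/-- For pairs of ports, a list of `X` checks and a list of data qubits such that hook errors on this
pair in these checks, together with errors on these data qubits, flip `zLogical`. -/
def pairErrors : List ((Fin 6 × Fin 6) × List GrossGroup × List (GrossGroup ⊕ GrossGroup)) :=
  [((0, 2), [(8, 4), (9, 5)], [.inl (1, 1), .inr (0, 1), .inr (2, 4), .inr (2, 5), .inr (5, 3),
      .inr (9, 3), .inr (9, 4), .inr (10, 5)]),
    ((1, 2), [(7, 2), (7, 5), (8, 2), (8, 5)], [.inr (7, 0), .inr (7, 1), .inr (7, 3),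
      .inr (7, 4)]),
    ((0, 3), [(1, 3), (9, 3)], [.inl (1, 4), .inl (3, 1), .inl (5, 4), .inl (7, 1), .inr (1, 1),
      .inr (2, 2), .inr (5, 1), .inr (6, 2)]),
    ((1, 3), [(1, 4), (3, 0), (5, 2), (7, 4), (9, 0), (11, 2)], []),
    ((2, 3), [(4, 3), (5, 1), (5, 3)], [.inl (4, 1), .inl (6, 0), .inl (6, 4), .inr (4, 3),
      .inr (4, 4), .inr (4, 5)]),
    ((0, 4), [(1, 5), (3, 1), (5, 3), (7, 5), (9, 1), (11, 3)], []),
    ((1, 4), [(6, 5), (7, 0)], [.inl (6, 5), .inl (7, 5), .inl (8, 3), .inl (8, 5), .inl (9, 0),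
      .inr (6, 1), .inr (7, 0), .inr (7, 3)]),
    ((2, 4), [(0, 4), (1, 0), (4, 5), (5, 0)], [.inl (7, 5), .inr (0, 2), .inr (2, 5),
      .inr (9, 4)]),
    ((0, 5), [(4, 0), (4, 2), (5, 1), (5, 3)], [.inl (6, 2), .inl (6, 4), .inr (6, 1),
      .inr (6, 3)]),
    ((1, 5), [(1, 4), (6, 0), (10, 0)], [.inl (7, 2), .inl (9, 5), .inl (11, 2), .inr (7, 4),
      .inr (7, 5), .inr (11, 5)]),
    ((2, 5), [(0, 5), (2, 1), (4, 3), (6, 5), (8, 1), (10, 3)], []),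
    ((3, 5), [(0, 0), (3, 4), (6, 3), (9, 1)], [.inl (1, 2), .inl (5, 2), .inl (7, 5),
      .inl (11, 5)]),
    ((4, 5), [(2, 3), (3, 4)], [.inl (3, 1), .inl (3, 2), .inl (4, 1), .inl (4, 5), .inl (5, 3),
      .inl (5, 5), .inl (6, 4), .inr (4, 5)])]

theorem flipsZLogical_of_mem_pairErrors : ∀ x ∈ pairErrors,
    FlipsZLogical (portPairs x.1.1 x.1.2 x.2.1 ++ x.2.2) := by
  decide +kernel

theorem length_add_length_le_of_mem_pairErrors : ∀ x ∈ pairErrors,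
    x.2.1.length + x.2.2.length ≤ 10 := by
  decide

theorem exists_mem_pairErrors : ∀ s : Finset (Fin 6), s.card = 2 → s ≠ {0, 1} → s ≠ {3, 4} →
    ∃ x ∈ pairErrors, x.1.1 ≠ x.1.2 ∧ s = {x.1.1, x.1.2} := by
  decide +kernel

theorem flipsZLogical_portPairs_zero_one_three_four :
    FlipsZLogical (portPairs 0 1 [(10, 5), (11, 2)] ++ portPairs 3 4 [(0, 1), (3, 5)] ++
      [.inl (3, 2), .inl (4, 2), .inr (0, 2), .inr (0, 3), .inr (4, 4), .inr (7, 3)]) := by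
  decide +kernel

theorem IsHook.basisDistance_le {s : Finset (Fin 6)} (h : IsHook S s) (hs : s.card = 2)
    (h01 : s ≠ {0, 1}) (h34 : s ≠ {3, 4}) (hS : S.NonInterleaved) {m : ℕ} (hm : 0 < m)
    (noisyBoundary : Bool) : S.basisDistance m noisyBoundary .Z ≤ 10 := by
  obtain ⟨x, hx, hne, rfl⟩ := exists_mem_pairErrors s hs h01 h34
  have herror := (h.causesXError_portPairs hne x.2.1).add (causesXError_errorOn x.2.2)
  rw [← errorOn_append] at herror
  exact ((flipsZLogical_of_mem_pairErrors x hx).basisDistance_le herror hS hm noisyBoundary).trans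
    (Nat.cast_le.2 (length_add_length_le_of_mem_pairErrors x hx))

theorem basisDistance_le_of_isHook_zero_one_of_isHook_three_four (h01 : IsHook S {0, 1})
    (h34 : IsHook S {3, 4}) (hS : S.NonInterleaved) {m : ℕ} (hm : 0 < m) (noisyBoundary : Bool) :
    S.basisDistance m noisyBoundary .Z ≤ 10 := by
  have herror := ((h01.causesXError_portPairs (by decide) [(10, 5), (11, 2)]).add
    (h34.causesXError_portPairs (by decide) [(0, 1), (3, 5)])).add (causesXError_errorOn
      [.inl (3, 2), .inl (4, 2), .inr (0, 2), .inr (0, 3), .inr (4, 4), .inr (7, 3)])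
  rw [← errorOn_append, ← errorOn_append] at herror
  exact flipsZLogical_portPairs_zero_one_three_four.basisDistance_le herror hS hm noisyBoundary

end GrossCode

theorem mainTheorem4 (S : SEC grossCode) (hS : S.NonInterleaved) (hU : UniformlyTiled S)
    (m : ℕ) (hm : 1 ≤ m) (noisyBoundary : Bool) :
    S.circuitDistance m noisyBoundary ≤ 10 := by
  refine (min_le_right _ _).trans ?_
  obtain ⟨σ, hσ⟩ := hU.exists_perm_strictMono
  have hfirst := IsHook.map_Iic hσ 1
  have hlast := IsHook.map_Ioi hσ 3
  have hne : (Finset.Iic 1).map σ.toEmbedding ≠ (Finset.Ioi 3).map σ.toEmbedding :=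
    (Finset.map_injective _).ne (by decide)
  by_contra hd
  have hexceptional (s : Finset (Fin 6)) (hs : IsHook S s) (hcard : s.card = 2) :
      s = {0, 1} ∨ s = {3, 4} := by
    by_contra! h
    exact hd (hs.basisDistance_le hcard h.1 h.2 hS hm noisyBoundary)
  obtain h | h := hexceptional _ hfirst (Finset.card_map _) <;>
    obtain h' | h' := hexceptional _ hlast (Finset.card_map _)
  · exact hne (h.trans h'.symm)
  · exact hd (basisDistance_le_of_isHook_zero_one_of_isHook_three_four (h ▸ hfirst) (h' ▸ hlast) hS
      hm _)
  · exact hd (basisDistance_le_of_isHook_zero_one_of_isHook_three_four (h' ▸ hlast) (h ▸ hfirst) hS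
      hm _)
  · exact hne (h.trans h'.symm)
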